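/- Let $b>1$ be an integer and let $A\subset\{0,1,\dots,b-1\}$ have cardinality $N$ with $1<N<b$. Put $N_1=\#(A\setminus\{0\})$, $\gamma_j=\sum_{a\in A}a^j$ and $\alpha_A(t)=\sum_{a\in A}e^{at}$. Call an integer $n>0$ admissible if all digits of its base-$b$ representation belong to $A$, and let $K(s)=\sum_{n>0,\ n\text{ admissible}}n^{-s}$, which converges for $\operatorname{Re}s>\log_bN$. Then $K$ has a meromorphic continuation to $\mathbb C$, again denoted $K$, which is analytic at the points $0,-1,-2,\dots$, and the following hold. (1) All the values $K(-m)$, $m\ge 0$, are rational, $K(0)=-N_1/(N-1)$, and for every $m\geq 1$ $$(b^{-m}-N)K(-m)=\frac{\gamma_m}{b^m}+\sum_{j=1}^m\binom mj\frac{\gamma_j}{b^j}K(-m+j).$$ (2) One has $0\in A$ if and only if $K(0)=-1$, and in that case $K(-m)=0$ for every $m\ge 1$. (3) One has $0\notin A$ if and only if $N_1=N$, if and only if $K(0)<-1$. In that case the exponential generating function $C(t)=\sum_{m\ge0}K(-m)\frac{t^m}{m!}$ satisfies, as a formal power series, $$C(b^{-1}t)=\alpha_A(b^{-1}t)+\alpha_A(b^{-1}t)\,C(t).$$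 It has a positive radius of convergence and extends to a meromorphic function $C$ on $\mathbb C$. At every point $t$ outside the set $P=\{b^jz:\ j\ge1,\ \alpha_A(z)=0\}$, the function $C$ is analytic, satisfies the same functional equation, and is given by $$C(t)=-1-\sum_{k=1}^\infty\frac1{\prod_{j=1}^k\alpha_A(b^{-j}t)},$$ where the series converges geometrically: there are $c>0$ and $0<q<1$ (depending on $t$) such that the $k$-th term is at most $cq^k$ in absolute value for all $k\ge1$. -/

import Mathlib

namespace RestrictedDirichlet

/-- `n` is admissible: every digit of its minimal base-`b` representation lies in `A`. -/
def IsAdmissible (b : ℕ) (A : Finset ℕ) (n : ℕ) : Prop :=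
  ∀ d ∈ Nat.digits b n, d ∈ A

/-- The coefficients of the restricted Dirichlet series: `1` on admissible integers, else `0`.
(The Dirichlet series `LSeries` ignores the coefficient with index `0`.) -/
noncomputable def coeff (b : ℕ) (A : Finset ℕ) : ℕ → ℂ :=
  Set.indicator {n : ℕ | IsAdmissible b A n} (fun _ => 1)

/-- `K` is the meromorphic function on `ℂ` continuing the restricted Dirichlet series
`∑' n ^ (-s)` (sum over the admissible `n > 0`) from the half-plane `re s > log_b (#A)`.
Normal form fixes the values of `K` everywhere: at each point that is not a pole `K` is analytic,
and at poles it has the conventional value `0`. -/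
structure IsContinuation (b : ℕ) (A : Finset ℕ) (K : ℂ → ℂ) : Prop where
  meromorphic : MeromorphicNFOn K Set.univ
  hasSum : ∀ s : ℂ, Real.logb b A.card < s.re → LSeriesHasSum (coeff b A) s (K s)

/-- The power sums `γ_j = ∑_{a ∈ A} a ^ j`. -/
noncomputable def powerSum (A : Finset ℕ) (j : ℕ) : ℂ := ∑ a ∈ A, (a : ℂ) ^ j

/-- `α_A(t) = ∑_{a ∈ A} exp (a t)`. -/
noncomputable def alpha (A : Finset ℕ) (t : ℂ) : ℂ := ∑ a ∈ A, Complex.exp (a * t)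

/-- The Taylor series of `α_A` at `0`, as a formal power series. -/
noncomputable def alphaSeries (A : Finset ℕ) : PowerSeries ℂ :=
  ∑ a ∈ A, PowerSeries.rescale (a : ℂ) (PowerSeries.exp ℂ)

/-- The exponential generating function `∑ K(-m) t ^ m / m!`, as a formal power series. -/
noncomputable def egf (K : ℂ → ℂ) : PowerSeries ℂ :=
  PowerSeries.mk fun m => K (-(m : ℂ)) / (m.factorial : ℂ)

/-- The set `{b ^ j z : j ≥ 1, α_A(z) = 0}`. -/
def exceptionalSet (b : ℕ) (A : Finset ℕ) : Set ℂ :=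
  {t | ∃ j : ℕ, 1 ≤ j ∧ ∃ z : ℂ, alpha A z = 0 ∧ t = (b : ℂ) ^ j * z}

/-- The term `1 / ∏_{j = 1}^k α_A(b ^ (-j) t)`. -/
noncomputable def term (b : ℕ) (A : Finset ℕ) (k : ℕ) (t : ℂ) : ℂ :=
  1 / ∏ j ∈ Finset.Icc 1 k, alpha A (t / (b : ℂ) ^ j)

end RestrictedDirichlet

namespace RestrictedDirichlet

open Filter Topology

/-! Split off the last digit, `n = q * b + a`. For `q ≠ 0` expand `(q b + a)^(-s) = (q b)^(-s) (1 +
a/(q b))^(-s)` by the binomial series and sum over `q` and `a`: K(s) equals the sum of `a^(-s)` over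
nonzero digits plus `∑_j choose(-s, j) γ_j b^(-s-j) K(s+j)` (`lseries_functional_equation`). Moving
the term `j = 0` to the left gives `(1 - N b^(-s)) K(s)` in terms of `K(s+1), K(s+2), ...`, which
continues K step by step to the left. Poles can only come from zeros of `1 - N b^(-(s+k))`, and
there are none at integers because `1 < N < b`.

At `s = -m` the coefficients `choose(m, j)` vanish for `j > m`, so the equation becomes a finite
recurrence (`continuation_neg_nat`). Rationality and the case `0 ∈ A` follow by induction.

If `0 ∉ A`, the recurrence is the functional equation of the generating function read
coefficientwise, and it has only one solution since `b^(-m) ≠ N`. The explicit series `egfSum`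
satisfies the same equation and is analytic near 0, where `α_A` is close to `N ≥ 2`; hence its
Taylor coefficients are the values of K. Its properties spread from a small disc to the plane
through `t ↦ t / b`. -/

/-! ### Binomial coefficients with complex upper argument. -/

theorem choose_succ_eq (a : ℂ) (j : ℕ) :
    Ring.choose a (j + 1) = Ring.choose a j * ((a - j) / (j + 1)) := by
  have h := Ring.descPochhammer_eq_factorial_smul_choose a (j + 1)
  have h' := Ring.descPochhammer_eq_factorial_smul_choose a j
  rw [descPochhammer_succ_right, Polynomial.smeval_mul, h'] at h
  have h2 : (Polynomial.X - (j : Polynomial ℤ)).smeval a = a - j := by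
    simp [Polynomial.smeval_sub, Polynomial.smeval_natCast]
  rw [h2, Nat.factorial_succ] at h
  have hf : (j.factorial : ℂ) ≠ 0 := by exact_mod_cast j.factorial_ne_zero
  have hj : (j : ℂ) + 1 ≠ 0 := by exact_mod_cast j.succ_ne_zero
  simp only [nsmul_eq_mul] at h
  push_cast at h
  field_simp
  apply mul_left_cancel₀ hf
  linear_combination -h

theorem differentiable_choose_neg (j : ℕ) : Differentiable ℂ fun s : ℂ => Ring.choose (-s) j := by
  induction j with
  | zero => simp
  | succ j ih =>
    simp only [choose_succ_eq]
    fun_prop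

/-- Factor by factor, `|-s - j| ≤ R + j = |-R - j|`. The bound is uniform in `s`, which later gives
locally uniform convergence. -/
theorem norm_choose_neg_le {s : ℂ} {R : ℝ} (hs : ‖s‖ ≤ R) (j : ℕ) :
    ‖Ring.choose (-s) j‖ ≤ ‖Ring.choose (-(R : ℂ)) j‖ := by
  have hR : 0 ≤ R := (norm_nonneg s).trans hs
  induction j with
  | zero => simp
  | succ j ih =>
    simp only [choose_succ_eq, norm_mul, norm_div]
    gcongr
    rw [show -s - (j : ℂ) = -(s + j) by ring, show -(R : ℂ) - (j : ℂ) = -((R + j : ℝ) : ℂ) by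
      push_cast; ring, norm_neg, norm_neg, Complex.norm_real, Real.norm_of_nonneg (by positivity)]
    exact (norm_add_le _ _).trans (by simpa using hs)

theorem hasSum_choose_mul_pow (a : ℂ) {z : ℂ} (hz : ‖z‖ < 1) :
    HasSum (fun j : ℕ => Ring.choose a j * z ^ j) ((1 + z) ^ a) := by
  have h := (Complex.one_add_cpow_hasFPowerSeriesOnBall_zero (a := a)).hasSum (y := z)
    (by rwa [Metric.mem_eball, edist_zero_right, ← ofReal_norm, ENNReal.ofReal_lt_one])
  simpa [binomialSeries, smul_eq_mul, mul_comm] using h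

theorem summable_norm_choose_mul_pow (a : ℂ) {x : ℝ} (hx : 0 ≤ x) (hx1 : x < 1) :
    Summable fun j : ℕ => ‖Ring.choose a j‖ * x ^ j := by
  have h := (hasSum_choose_mul_pow a (z := x)
    (by simpa [abs_of_nonneg hx] using hx1)).summable.norm
  simpa [abs_of_nonneg hx] using h

/-! ### The Dirichlet series: convergence and functional equation. -/

variable {b : ℕ} {A : Finset ℕ}

theorem coeff_zero : coeff b A 0 = 1 := by simp [coeff, IsAdmissible]

/-- The case `q = a = 0` is excluded because 0 has an empty digit list, hence coefficient 1 whether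
or not `0 ∈ A`. -/
theorem coeff_mul_add (hb : 1 < b) {q a : ℕ} (ha : a < b) (h : a ≠ 0 ∨ q ≠ 0) :
    coeff b A (q * b + a) = if a ∈ A then coeff b A q else 0 := by
  have hd : Nat.digits b (q * b + a) = a :: Nat.digits b q := by
    rw [add_comm, mul_comm]; exact Nat.digits_add b hb a q ha h
  have hiff : IsAdmissible b A (q * b + a) ↔ a ∈ A ∧ IsAdmissible b A q := by
    simp [IsAdmissible, hd]
  unfold coeff
  by_cases h1 : a ∈ A <;> by_cases h2 : IsAdmissible b A q <;> simp [hiff, h1, h2]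

/-- `∑ a ^ (-s)` over the nonzero digits. -/
noncomputable def digitSum (A : Finset ℕ) (s : ℂ) : ℂ := ∑ a ∈ A.erase 0, (a : ℂ) ^ (-s)

/-- The coefficient of `K (s + j)` in the functional equation. -/
noncomputable def shiftCoeff (b : ℕ) (A : Finset ℕ) (s : ℂ) (j : ℕ) : ℂ :=
  Ring.choose (-s) j * powerSum A j * (b : ℂ) ^ (-(s + j))

theorem sum_fin_ite {M : Type*} [AddCommMonoid M] (hA : ∀ a ∈ A, a < b) (f : ℕ → M) :
    ∑ a : Fin b, (if (a : ℕ) ∈ A then f a else 0) = ∑ a ∈ A, f a := by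
  rw [Fin.sum_univ_eq_sum_range (fun a => if a ∈ A then f a else 0) b, ← Finset.sum_filter]
  congr 1
  ext a
  simp only [Finset.mem_filter, Finset.mem_range]
  exact ⟨fun h => h.2, fun h => ⟨hA a h, h⟩⟩

theorem term_mul_add (hb : 1 < b) {q : ℕ} (hq : q ≠ 0) {a : ℕ} (ha : a < b) (s : ℂ) :
    LSeries.term (coeff b A) s (q * b + a) =
      if a ∈ A then coeff b A q / ((q : ℂ) * b + a) ^ s else 0 := by
  have h0 : q * b + a ≠ 0 := by positivity
  rw [LSeries.term_of_ne_zero h0, coeff_mul_add hb ha (Or.inr hq)]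
  split_ifs <;> simp

theorem sum_term_digit (hb : 1 < b) (hA : ∀ a ∈ A, a < b) (s : ℂ) :
    ∑ a : Fin b, LSeries.term (coeff b A) s (0 * b + a) = digitSum A s := by
  have h (a : Fin b) : LSeries.term (coeff b A) s (0 * b + a) =
      if (a : ℕ) ∈ A then (if (a : ℕ) = 0 then 0 else ((a : ℕ) : ℂ) ^ (-s)) else 0 := by
    by_cases h0 : (a : ℕ) = 0
    · simp [h0]
    · rw [LSeries.term_of_ne_zero (by omega), coeff_mul_add hb a.2 (Or.inl h0), coeff_zero]
      simp only [h0, if_false, zero_mul, zero_add, Complex.cpow_neg]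
      split_ifs <;> simp
  simp only [h]
  rw [sum_fin_ite hA (fun a => if a = 0 then 0 else (a : ℂ) ^ (-s)), digitSum]
  rw [← Finset.sum_erase A (a := 0) (by simp)]
  exact Finset.sum_congr rfl fun a ha => if_neg (Finset.ne_of_mem_erase ha)

theorem logb_card_pos (hN : 1 < A.card) (hb : 1 < b) : 0 < Real.logb b A.card :=
  Real.logb_pos (by exact_mod_cast hb) (by exact_mod_cast hN)

theorem card_mul_rpow_lt_one (hN : 1 < A.card) (hb : 1 < b) {σ : ℝ}
    (hσ : Real.logb b A.card < σ) : (A.card : ℝ) * (b : ℝ) ^ (-σ) < 1 := by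
  have hb' : (1 : ℝ) < b := by exact_mod_cast hb
  rw [Real.logb_lt_iff_lt_rpow hb' (by positivity)] at hσ
  rw [Real.rpow_neg (by positivity), ← div_eq_mul_inv, div_lt_one (by positivity)]
  exact hσ

/-- With `S_X` the sum of the norms over `n < X` and `ρ = N b^(-Re s) < 1`, grouping by last digit
gives `S_X ≤ S_{Xb} ≤ E + ρ S_X`, so `S_X ≤ E / (1 - ρ)`. -/
theorem lseriesSummable_coeff (hA : ∀ a ∈ A, a < b) (hN : 1 < A.card) (hb : 1 < b) {s : ℂ}
    (hs : Real.logb b A.card < s.re) : LSeriesSummable (coeff b A) s := by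
  have hσ : 0 ≤ s.re := ((logb_card_pos hN hb).trans hs).le
  have hρ := card_mul_rpow_lt_one hN hb hs
  set ρ : ℝ := (A.card : ℝ) * (b : ℝ) ^ (-s.re)
  set f : ℕ → ℝ := fun n => ‖LSeries.term (coeff b A) s n‖
  set E : ℝ := ∑ a : Fin b, f (0 * b + a)
  have hE : 0 ≤ E := Finset.sum_nonneg fun _ _ => norm_nonneg _
  have inner (q : ℕ) : ∑ a : Fin b, f (q * b + a) ≤ (if q = 0 then E else 0) + ρ * f q := by
    by_cases hq : q = 0
    · subst hq; simp [E, f]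
    have hq0 : (0 : ℝ) < q := by positivity
    have h (a : Fin b) : f (q * b + a) ≤ if (a : ℕ) ∈ A then (b : ℝ) ^ (-s.re) * f q else 0 := by
      simp only [f]
      rw [term_mul_add hb hq a.2]
      split_ifs with haA
      · rw [LSeries.term_of_ne_zero hq, norm_div, norm_div]
        rw [show (q : ℂ) * b + (a : ℕ) = ((q * b + a : ℕ) : ℂ) by push_cast; rfl]
        rw [Complex.norm_natCast_cpow_of_pos (by positivity),
          Complex.norm_natCast_cpow_of_pos (by positivity)]
        have : (b : ℝ) ^ (-s.re) * (‖coeff b A q‖ / (q : ℝ) ^ s.re) =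
            ‖coeff b A q‖ / ((q : ℝ) * b) ^ s.re := by
          rw [Real.mul_rpow (by positivity) (by positivity), Real.rpow_neg (by positivity)]
          field_simp
        rw [this]
        gcongr
        push_cast
        linarith [(Nat.cast_nonneg (a : ℕ) : (0 : ℝ) ≤ _)]
      · simp
    calc ∑ a : Fin b, f (q * b + a)
        ≤ ∑ a : Fin b, if (a : ℕ) ∈ A then (b : ℝ) ^ (-s.re) * f q else 0 :=
          Finset.sum_le_sum fun a _ => h a
      _ = _ := by
          rw [sum_fin_ite hA (fun _ => (b : ℝ) ^ (-s.re) * f q)]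
          simp [hq, ρ, mul_assoc]
  have split (X : ℕ) : ∑ n ∈ Finset.range (X * b), f n =
      ∑ q ∈ Finset.range X, ∑ a : Fin b, f (q * b + a) := by
    induction X with
    | zero => simp
    | succ X ih =>
      rw [Finset.sum_range_succ, ← ih, add_mul, one_mul, Finset.sum_range_add,
        Fin.sum_univ_eq_sum_range (fun a => f (X * b + a)) b]
  refine Summable.of_norm (summable_of_sum_range_le (c := E / (1 - ρ)) (fun _ => norm_nonneg _)
    fun X => ?_)
  change ∑ n ∈ Finset.range X, f n ≤ _
  have h1 : ∑ n ∈ Finset.range X, f n ≤ ∑ n ∈ Finset.range (X * b), f n :=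
    Finset.sum_le_sum_of_subset_of_nonneg
      (Finset.range_subset_range.2 (Nat.le_mul_of_pos_right X (by omega)))
      fun _ _ _ => norm_nonneg _
  have h2 : ∑ n ∈ Finset.range (X * b), f n ≤ E + ρ * ∑ n ∈ Finset.range X, f n := by
    rw [split]
    refine (Finset.sum_le_sum fun q _ => inner q).trans ?_
    rw [Finset.sum_add_distrib, Finset.mul_sum]
    gcongr
    rw [Finset.sum_ite_eq']
    split_ifs <;> simp [hE]
  rw [le_div_iff₀ (by linarith)]
  linarith

/-- The base `b - 1` rather than `b` matters: after division by `b ^ j` it leaves a geometric ratio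
below 1. -/
theorem norm_powerSum_le (hA : ∀ a ∈ A, a < b) (j : ℕ) :
    ‖powerSum A j‖ ≤ A.card * ((b : ℝ) - 1) ^ j := by
  refine (norm_sum_le _ _).trans ((Finset.sum_le_card_nsmul _ _ _ fun a ha => ?_).trans
    (le_of_eq (nsmul_eq_mul _ _)))
  rw [norm_pow, Complex.norm_natCast]
  gcongr
  have : (a : ℝ) + 1 ≤ b := by exact_mod_cast hA a ha
  linarith

theorem norm_shiftCoeff_le (hA : ∀ a ∈ A, a < b) (hb : 1 < b) {s : ℂ} {R : ℝ} (hs : ‖s‖ ≤ R)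
    (j : ℕ) : ‖shiftCoeff b A s j‖ ≤
      A.card * (b : ℝ) ^ R * (‖Ring.choose (-(R : ℂ)) j‖ * (((b : ℝ) - 1) / b) ^ j) := by
  have hb0 : (0 : ℝ) < b := by positivity
  have hb1 : (1 : ℝ) < b := by exact_mod_cast hb
  have h1 : ‖(b : ℂ) ^ (-(s + j))‖ ≤ (b : ℝ) ^ R * ((b : ℝ) ^ j)⁻¹ := by
    rw [Complex.norm_natCast_cpow_of_pos (by omega), ← Real.rpow_natCast,
      ← Real.rpow_neg hb0.le, ← Real.rpow_add hb0]
    apply Real.rpow_le_rpow_of_exponent_le hb1.le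
    have := (abs_le.1 (Complex.abs_re_le_norm s)).1
    simp
    linarith
  have hb2 : (0 : ℝ) ≤ b - 1 := by linarith
  rw [shiftCoeff, norm_mul, norm_mul]
  calc _ ≤ ‖Ring.choose (-(R : ℂ)) j‖ * (A.card * ((b : ℝ) - 1) ^ j) *
        ((b : ℝ) ^ R * ((b : ℝ) ^ j)⁻¹) := by
        gcongr
        · exact norm_choose_neg_le hs j
        · exact norm_powerSum_le hA j
    _ = _ := by rw [div_pow]; ring

theorem summable_shiftCoeff_bound (hb : 1 < b) (R : ℝ) : Summable fun j : ℕ =>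
    A.card * (b : ℝ) ^ R * (‖Ring.choose (-(R : ℂ)) j‖ * (((b : ℝ) - 1) / b) ^ j) := by
  have hb1 : (1 : ℝ) < b := by exact_mod_cast hb
  apply Summable.mul_left
  apply summable_norm_choose_mul_pow
  · apply div_nonneg <;> linarith
  · rw [div_lt_one (by linarith)]; linarith

theorem summable_norm_shiftCoeff (hA : ∀ a ∈ A, a < b) (hb : 1 < b) (s : ℂ) :
    Summable fun j : ℕ => ‖shiftCoeff b A s j‖ :=
  (summable_shiftCoeff_bound hb ‖s‖).of_nonneg_of_le (fun _ => norm_nonneg _)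
    (norm_shiftCoeff_le hA hb le_rfl)

/-- The binomial series of `(1 + a/(q b))^(-s)`, convergent because `a < b ≤ q b`. -/
theorem hasSum_shiftCoeff_mul_term (hA : ∀ a ∈ A, a < b) (hb : 1 < b) (s : ℂ) {q : ℕ}
    (hq : q ≠ 0) :
    HasSum (fun j : ℕ => shiftCoeff b A s j * LSeries.term (coeff b A) (s + j) q)
      (∑ a : Fin b, LSeries.term (coeff b A) s (q * b + a)) := by
  have hb0 : (b : ℂ) ≠ 0 := by exact_mod_cast (by omega : b ≠ 0)
  have hq0 : (q : ℂ) ≠ 0 := by exact_mod_cast hq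
  have e1 : ∑ a : Fin b, LSeries.term (coeff b A) s (q * b + a) =
      ∑ a ∈ A, coeff b A q / ((q : ℂ) * b + a) ^ s := by
    rw [← sum_fin_ite hA]
    exact Finset.sum_congr rfl fun a _ => term_mul_add hb hq a.2 s
  have e2 (j : ℕ) : shiftCoeff b A s j * LSeries.term (coeff b A) (s + j) q =
      ∑ a ∈ A, coeff b A q * ((q : ℂ) * b) ^ (-s) *
        (Ring.choose (-s) j * ((a : ℂ) / (q * b)) ^ j) := by
    rw [LSeries.term_of_ne_zero hq, shiftCoeff, powerSum, Finset.mul_sum, Finset.sum_mul,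
      Finset.sum_mul]
    refine Finset.sum_congr rfl fun a _ => ?_
    rw [Complex.natCast_mul_natCast_cpow, div_pow, mul_pow, Complex.cpow_neg, Complex.cpow_neg,
      Complex.cpow_neg, Complex.cpow_add _ _ hb0, Complex.cpow_add _ _ hq0, Complex.cpow_natCast,
      Complex.cpow_natCast]
    field_simp
  rw [e1]
  simp only [e2]
  refine hasSum_sum fun a ha => ?_
  have hlt : ‖(a : ℂ) / (q * b)‖ < 1 := by
    rw [norm_div, norm_mul, Complex.norm_natCast, Complex.norm_natCast, Complex.norm_natCast,
      div_lt_one (by positivity)]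
    have h1 : a < q * b := (hA a ha).trans_le (Nat.le_mul_of_pos_left b (by omega))
    exact_mod_cast h1
  have key := (hasSum_choose_mul_pow (-s) hlt).mul_left (coeff b A q * ((q : ℂ) * b) ^ (-s))
  rw [mul_assoc] at key
  have e3 : ((q : ℂ) * b) ^ (-s) * (1 + (a : ℂ) / (q * b)) ^ (-s) = ((q : ℂ) * b + a) ^ (-s) := by
    have : (q : ℂ) * b + a = ((q * b : ℝ) : ℂ) * ((1 + a / (q * b) : ℝ) : ℂ) := by
      push_cast; field_simp
    rw [this, Complex.mul_cpow_ofReal_nonneg (by positivity) (by positivity)]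
    push_cast; rfl
  rwa [e3, Complex.cpow_neg (_ + _), ← div_eq_mul_inv] at key

theorem tsum_eq_tsum_sum_fin [NeZero b] {f : ℕ → ℂ} (hf : Summable f) :
    ∑' n, f n = ∑' q, ∑ a : Fin b, f (q * b + a) := by
  have h1 := (Nat.divModEquiv b).symm.summable_iff.2 hf
  change Summable fun p => f ((Nat.divModEquiv b).symm p) at h1
  rw [← (Nat.divModEquiv b).symm.tsum_eq, Summable.tsum_prod h1]
  simp only [tsum_fintype, Nat.divModEquiv_symm_apply]

theorem lseries_functional_equation (hA : ∀ a ∈ A, a < b) (hN : 1 < A.card) (hb : 1 < b) {s : ℂ}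
    (hs : Real.logb b A.card < s.re) :
    LSeries (coeff b A) s = digitSum A s +
      ∑' j : ℕ, shiftCoeff b A s j * LSeries (coeff b A) (s + j) := by
  have hsum := lseriesSummable_coeff hA hN hb hs
  have : NeZero b := ⟨by omega⟩
  set F : ℕ → ℕ → ℂ := fun j q => shiftCoeff b A s j * LSeries.term (coeff b A) (s + j) q
  -- Since `Re (s + j) ≥ Re s`, a product of two summable families dominates the double series and
  -- permits the interchange of sums.
  have hbd : Summable fun p : ℕ × ℕ =>
      ‖shiftCoeff b A s p.1‖ * ‖LSeries.term (coeff b A) s p.2‖ :=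
    Summable.mul_of_nonneg (f := fun j => ‖shiftCoeff b A s j‖)
      (g := fun q => ‖LSeries.term (coeff b A) s q‖) (summable_norm_shiftCoeff hA hb s)
      (Summable.norm hsum) (fun _ => norm_nonneg _) fun _ => norm_nonneg _
  have hF : Summable (Function.uncurry F) := by
    refine Summable.of_norm_bounded hbd fun p => ?_
    simp only [F, Function.uncurry]
    rw [norm_mul]
    gcongr
    exact LSeries.norm_term_le_of_re_le_re _ (by simp) _
  have hswap : ∑' j : ℕ, shiftCoeff b A s j * LSeries (coeff b A) (s + j) =
      ∑' q, ∑' j, F j q := by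
    refine Eq.trans ?_ (Summable.tsum_comm (f := F) hF).symm
    exact tsum_congr fun j => tsum_mul_left.symm
  have hq (q : ℕ) : ∑ a : Fin b, LSeries.term (coeff b A) s (q * b + a) =
      (if q = 0 then digitSum A s else 0) + ∑' j, F j q := by
    by_cases h : q = 0
    · subst h
      rw [sum_term_digit hb hA]
      simp [F]
    · rw [if_neg h, zero_add]
      exact (hasSum_shiftCoeff_mul_term hA hb s h).tsum_eq.symm
  have e : LSeries (coeff b A) s =
      ∑' q, ∑ a : Fin b, LSeries.term (coeff b A) s (q * b + a) := 
    tsum_eq_tsum_sum_fin hsum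
  rw [e, hswap]
  simp only [hq]
  rw [Summable.tsum_add (summable_of_ne_finset_zero (s := {0}) (by simp +contextual)), tsum_ite_eq]
  exact hF.prod_symm.prod

/-! ### Meromorphic continuation and its uniqueness. -/

/-- Identity theorem: infinite order of `f - g` at one point propagates over the connected plane. -/
theorem eventuallyEq_nhdsNE_of_eventuallyEq_nhds {f g : ℂ → ℂ} (hf : ∀ z, MeromorphicAt f z)
    (hg : ∀ z, MeromorphicAt g z) {z₀ : ℂ} (h : f =ᶠ[𝓝 z₀] g) (z : ℂ) : f =ᶠ[𝓝[≠] z] g := by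
  have hm : MeromorphicOn (f - g) Set.univ := fun z _ => (hf z).sub (hg z)
  have h0 : meromorphicOrderAt (f - g) z₀ = ⊤ := by
    rw [meromorphicOrderAt_eq_top_iff]
    filter_upwards [h.filter_mono nhdsWithin_le_nhds] with w hw
    simp [hw]
  have hz : meromorphicOrderAt (f - g) z = ⊤ := by
    by_contra hne
    exact (hm.exists_meromorphicOrderAt_ne_top_iff_forall isConnected_univ).1
      ⟨⟨z, trivial⟩, hne⟩ ⟨z₀, trivial⟩ h0
  rw [meromorphicOrderAt_eq_top_iff] at hz
  filter_upwards [hz] with w hw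
  simpa [sub_eq_zero] using hw

/-- The analytic continuation of the restricted Dirichlet series, computed by moving `s` to the
right through the functional equation until the series converges. -/
noncomputable def continuation (b : ℕ) (A : Finset ℕ) (s : ℂ) : ℂ :=
  if Real.logb b A.card < s.re then LSeries (coeff b A) s
  else (1 - A.card * (b : ℂ) ^ (-s))⁻¹ *
    (digitSum A s + ∑' j : ℕ, shiftCoeff b A s (j + 1) * continuation b A (s + (j + 1 : ℕ)))
termination_by ⌊Real.logb b A.card + 1 - s.re⌋₊
decreasing_by
  rename_i h
  rw [not_lt] at h
  have h1 : Real.logb b A.card + 1 - (s + (j + 1 : ℕ)).re ≤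
      Real.logb b A.card + 1 - s.re - 1 := by
    simp only [Complex.add_re, Complex.natCast_re]
    push_cast
    linarith [(Nat.cast_nonneg j : (0 : ℝ) ≤ j)]
  have h2 := Nat.floor_le_floor h1
  rw [Nat.floor_sub_one] at h2
  -- The `+ 1` in the measure keeps it at least 1 outside the half-plane of convergence, so that the
  -- truncated subtraction is a strict decrease.
  have h3 : 1 ≤ ⌊Real.logb b A.card + 1 - s.re⌋₊ := Nat.le_floor (by push_cast; linarith)
  omega

theorem continuation_of_lt {s : ℂ} (h : Real.logb b A.card < s.re) :
    continuation b A s = LSeries (coeff b A) s := by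
  rw [continuation, if_pos h]

theorem norm_lseries_le (hA : ∀ a ∈ A, a < b) (hN : 1 < A.card) (hb : 1 < b) {σ : ℝ}
    (hσ : Real.logb b A.card < σ) {s : ℂ} (hs : σ ≤ s.re) :
    ‖LSeries (coeff b A) s‖ ≤ ∑' n, ‖LSeries.term (coeff b A) (σ : ℂ) n‖ := by
  have h1 : LSeriesSummable (coeff b A) (σ : ℂ) := lseriesSummable_coeff hA hN hb (by simpa)
  have h2 : LSeriesSummable (coeff b A) s := h1.of_re_le_re (by simpa)
  have h1' : Summable fun n => ‖LSeries.term (coeff b A) (σ : ℂ) n‖ := Summable.norm h1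
  have h2' : Summable fun n => ‖LSeries.term (coeff b A) s n‖ := Summable.norm h2
  have hle (n : ℕ) : ‖LSeries.term (coeff b A) s n‖ ≤ ‖LSeries.term (coeff b A) (σ : ℂ) n‖ :=
    LSeries.norm_term_le_of_re_le_re _ (by simpa) n
  exact (norm_tsum_le_tsum_norm h2').trans (h2'.tsum_le_tsum hle h1')

theorem norm_shiftCoeff_mul_continuation_le (hA : ∀ a ∈ A, a < b) (hN : 1 < A.card) (hb : 1 < b)
    {σ R : ℝ} (hσ : Real.logb b A.card < σ) {s : ℂ} (hs : ‖s‖ ≤ R) {j : ℕ} (hj : σ ≤ s.re + j) :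
    ‖shiftCoeff b A s j * continuation b A (s + j)‖ ≤
      A.card * (b : ℝ) ^ R * (‖Ring.choose (-(R : ℂ)) j‖ * (((b : ℝ) - 1) / b) ^ j) *
        ∑' n, ‖LSeries.term (coeff b A) (σ : ℂ) n‖ := by
  have hj' : σ ≤ (s + j).re := by simpa
  rw [norm_mul, continuation_of_lt (hσ.trans_le hj')]
  have := norm_shiftCoeff_le hA hb hs j
  exact mul_le_mul this (norm_lseries_le hA hN hb hσ hj') (norm_nonneg _)
    ((norm_nonneg _).trans this)

theorem summable_shiftCoeff_mul_continuation (hA : ∀ a ∈ A, a < b) (hN : 1 < A.card)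
    (hb : 1 < b) (s : ℂ) :
    Summable fun j : ℕ => shiftCoeff b A s j * continuation b A (s + j) := by
  obtain ⟨J, hJ⟩ := exists_nat_ge (Real.logb b A.card + 1 - s.re)
  rw [← summable_nat_add_iff J]
  refine Summable.of_norm_bounded (((summable_nat_add_iff J).2
    (summable_shiftCoeff_bound (A := A) hb ‖s‖)).mul_right
      (∑' n, ‖LSeries.term (coeff b A) ((Real.logb b A.card + 1 : ℝ) : ℂ) n‖)) fun j => ?_
  refine norm_shiftCoeff_mul_continuation_le hA hN hb (by linarith) le_rfl ?_
  push_cast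
  linarith [(Nat.cast_nonneg j : (0 : ℝ) ≤ j)]

theorem one_sub_card_mul_cpow_ne_zero (hN : 1 < A.card) (hb : 1 < b) {s : ℂ}
    (hs : Real.logb b A.card < s.re) : 1 - (A.card : ℂ) * (b : ℂ) ^ (-s) ≠ 0 := by
  intro h
  have h1 : ‖(A.card : ℂ) * (b : ℂ) ^ (-s)‖ = 1 := by
    rw [← sub_eq_zero.1 h, norm_one]
  rw [norm_mul, Complex.norm_natCast, Complex.norm_natCast_cpow_of_pos (by omega)] at h1
  have := card_mul_rpow_lt_one hN hb hs
  rw [Complex.neg_re] at h1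
  linarith

/-- `N` lies strictly between `b^0` and `b^1`, so it is not an integral power of `b`. -/
theorem one_sub_card_mul_cpow_int_ne_zero (hN : 1 < A.card) (hNb : A.card < b) (m : ℤ) :
    1 - (A.card : ℂ) * (b : ℂ) ^ (-(m : ℂ)) ≠ 0 := by
  have hb : (1 : ℚ) < b := by exact_mod_cast hN.trans hNb
  intro h
  have hb0 : (b : ℂ) ≠ 0 := by exact_mod_cast (by omega : b ≠ 0)
  rw [Complex.cpow_neg, Complex.cpow_intCast, sub_eq_zero, ← div_eq_mul_inv,
    eq_div_iff (zpow_ne_zero _ hb0), one_mul] at h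
  have h' : (b : ℚ) ^ m = A.card := by
    apply Rat.cast_injective (α := ℂ)
    push_cast
    exact h
  have h1 : (b : ℚ) ^ (0 : ℤ) < (b : ℚ) ^ m := by rw [h', zpow_zero]; exact_mod_cast hN
  have h2 : (b : ℚ) ^ m < (b : ℚ) ^ (1 : ℤ) := by rw [h', zpow_one]; exact_mod_cast hNb
  rw [zpow_lt_zpow_iff_right₀ hb] at h1 h2
  omega

/-- Where the series converges this is the functional equation with its term `j = 0`, namely `N
b^(-s) K(s)`, moved to the left; elsewhere it is the definition. -/
theorem continuation_eq (hA : ∀ a ∈ A, a < b) (hN : 1 < A.card) (hb : 1 < b) (s : ℂ) :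
    continuation b A s = (1 - A.card * (b : ℂ) ^ (-s))⁻¹ *
      (digitSum A s +
        ∑' j : ℕ, shiftCoeff b A s (j + 1) * continuation b A (s + (j + 1 : ℕ))) := by
  by_cases h : Real.logb b A.card < s.re
  · have h1 := lseries_functional_equation hA hN hb h
    have h2 : ∀ j : ℕ, LSeries (coeff b A) (s + j) = continuation b A (s + j) := fun j =>
      (continuation_of_lt (h.trans_le (by simp))).symm
    simp only [h2] at h1
    rw [(summable_shiftCoeff_mul_continuation hA hN hb s).tsum_eq_zero_add] at h1
    have h3 := one_sub_card_mul_cpow_ne_zero hN hb h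
    have h4 : shiftCoeff b A s 0 = A.card * (b : ℂ) ^ (-s) := by
      simp [shiftCoeff, powerSum]
    rw [← continuation_of_lt h, h4, Nat.cast_zero, add_zero] at h1
    rw [eq_inv_mul_iff_mul_eq₀ h3]
    linear_combination h1
  · rw [continuation, if_neg h]

theorem differentiable_natCast_cpow_neg {n : ℕ} (hn : n ≠ 0) (c : ℂ) :
    Differentiable ℂ fun s : ℂ => (n : ℂ) ^ (-(s + c)) := fun s =>
  DifferentiableAt.const_cpow (by fun_prop) (Or.inl (by exact_mod_cast hn))

theorem differentiable_shiftCoeff (hb : 1 < b) (j : ℕ) :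
    Differentiable ℂ fun s => shiftCoeff b A s j :=
  ((differentiable_choose_neg j).mul_const _).mul
    (differentiable_natCast_cpow_neg (by omega) _)

theorem differentiable_digitSum : Differentiable ℂ (digitSum A) := by
  refine Differentiable.fun_sum fun a ha => ?_
  simpa using differentiable_natCast_cpow_neg (Finset.ne_of_mem_erase ha) 0

theorem differentiable_one_sub_card_mul_cpow (hb : 1 < b) :
    Differentiable ℂ fun s : ℂ => 1 - (A.card : ℂ) * (b : ℂ) ^ (-s) := by
  simpa using ((differentiable_natCast_cpow_neg (n := b) (by omega) 0).const_mul
    (A.card : ℂ)).const_sub 1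

/-- Near any point, the continuation is determined by finitely many of its translates up to
an analytic function. -/
theorem exists_continuation_eq (hA : ∀ a ∈ A, a < b) (hN : 1 < A.card) (hb : 1 < b) (s₀ : ℂ) :
    ∃ (J : ℕ) (T : ℂ → ℂ), AnalyticAt ℂ T s₀ ∧
      continuation b A = fun s => (1 - (A.card : ℂ) * (b : ℂ) ^ (-s))⁻¹ *
        (digitSum A s + (∑ j ∈ Finset.range J,
          shiftCoeff b A s (j + 1) * continuation b A (s + (j + 1 : ℕ)) + T s)) := by
  set σ := Real.logb b A.card + 1 with hσ
  -- Chosen so that, for `s` in the unit ball about `s₀`, every shift by more than `J` lands where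
  -- the series converges with a uniform bound.
  obtain ⟨J, hJ⟩ := exists_nat_ge (σ + 1 - s₀.re)
  refine ⟨J, fun s => ∑' j : ℕ, shiftCoeff b A s (j + J + 1) *
    continuation b A (s + (j + J + 1 : ℕ)), ?_, ?_⟩
  · have hre : ∀ s ∈ Metric.ball s₀ 1, ∀ j : ℕ, σ < (s + (j + J + 1 : ℕ)).re := by
      intro s hs j
      have h1 := (abs_lt.1 ((Complex.abs_re_le_norm (s - s₀)).trans_lt
        (mem_ball_iff_norm.1 hs))).1
      simp only [Complex.sub_re] at h1
      simp only [Complex.add_re, Complex.natCast_re]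
      push_cast
      linarith [(Nat.cast_nonneg j : (0 : ℝ) ≤ j)]
    refine DifferentiableOn.analyticAt (s := Metric.ball s₀ 1) ?_
      (Metric.ball_mem_nhds _ one_pos)
    refine Complex.differentiableOn_tsum_of_summable_norm
      (((summable_nat_add_iff (J + 1)).2 (summable_shiftCoeff_bound (A := A) hb
        (‖s₀‖ + 1))).mul_right
        (∑' n, ‖LSeries.term (coeff b A) (σ : ℂ) n‖)) ?_ Metric.isOpen_ball ?_
    · intro j s hs
      refine ((differentiable_shiftCoeff hb _ s).mul ?_).differentiableWithinAt
      have hlt : LSeries.abscissaOfAbsConv (coeff b A) < ((s + (j + J + 1 : ℕ)).re : EReal) := by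
        refine lt_of_le_of_lt (LSeries.abscissaOfAbsConv_le_of_forall_lt_LSeriesSummable
          (x := Real.logb b A.card) fun y hy =>
            lseriesSummable_coeff hA hN hb (by simpa using hy)) ?_
        exact EReal.coe_lt_coe_iff.2 ((lt_add_one _).trans (hre s hs j))
      have hL := (LSeries_hasDerivAt hlt).differentiableAt
      have hev : continuation b A =ᶠ[𝓝 (s + (j + J + 1 : ℕ))] LSeries (coeff b A) := by
        filter_upwards [(isOpen_lt continuous_const Complex.continuous_re).mem_nhds
          (show σ < (s + (j + J + 1 : ℕ)).re from hre s hs j)] with w hw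
        exact continuation_of_lt ((lt_add_one _).trans hw)
      exact DifferentiableAt.comp s (hL.congr_of_eventuallyEq hev) (by fun_prop)
    · intro j s hs
      refine norm_shiftCoeff_mul_continuation_le hA hN hb (lt_add_one _) ?_ ?_
      · have h1 := mem_ball_iff_norm.1 hs
        have h2 := norm_sub_norm_le s s₀
        linarith
      · simpa using (hre s hs j).le
  · funext s
    have h1 := (summable_nat_add_iff 1).2 (summable_shiftCoeff_mul_continuation hA hN hb s)
    rw [continuation_eq hA hN hb s, ← h1.sum_add_tsum_nat_add J]

theorem analyticAt_continuation_of_lt (hA : ∀ a ∈ A, a < b) (hN : 1 < A.card) (hb : 1 < b)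
    {s : ℂ} (hs : Real.logb b A.card < s.re) : AnalyticAt ℂ (continuation b A) s := by
  have hlt : LSeries.abscissaOfAbsConv (coeff b A) < (s.re : EReal) :=
    lt_of_le_of_lt (LSeries.abscissaOfAbsConv_le_of_forall_lt_LSeriesSummable
      (x := Real.logb b A.card) fun y hy => lseriesSummable_coeff hA hN hb (by simpa using hy))
      (EReal.coe_lt_coe_iff.2 hs)
  refine (LSeries_analyticOnNhd (coeff b A) s hlt).congr ?_
  filter_upwards [(isOpen_lt continuous_const Complex.continuous_re).mem_nhds hs] with w hw
  exact (continuation_of_lt hw).symm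

/-- Induction on the number of unit steps from `s` to the half-plane of convergence; each translate
on the right-hand side needs fewer. -/
theorem meromorphicAt_continuation (hA : ∀ a ∈ A, a < b) (hN : 1 < A.card) (hb : 1 < b)
    (s : ℂ) : MeromorphicAt (continuation b A) s := by
  obtain ⟨n, hn⟩ := exists_nat_gt (Real.logb b A.card - s.re)
  induction n generalizing s with
  | zero => exact (analyticAt_continuation_of_lt hA hN hb (by simpa using hn)).meromorphicAt
  | succ n ih =>
    obtain ⟨J, T, hT, heq⟩ := exists_continuation_eq hA hN hb s
    rw [heq]
    have hd := ((differentiable_one_sub_card_mul_cpow (A := A) hb).analyticAt s).meromorphicAt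
    refine hd.inv.mul (((differentiable_digitSum (A := A)).analyticAt s).meromorphicAt.add
      ((MeromorphicAt.fun_sum fun j _ => ?_).add hT.meromorphicAt))
    refine ((differentiable_shiftCoeff hb _).analyticAt s).meromorphicAt.mul
      (MeromorphicAt.comp_analyticAt (g := fun s : ℂ => s + (j + 1 : ℕ)) (ih _ ?_) (by fun_prop))
    simp only [Complex.add_re, Complex.natCast_re]
    push_cast at hn ⊢
    linarith [(Nat.cast_nonneg j : (0 : ℝ) ≤ j)]

theorem analyticAt_continuation (hA : ∀ a ∈ A, a < b) (hN : 1 < A.card) (hb : 1 < b)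
    (s : ℂ) (hs : ∀ k : ℕ, 1 - (A.card : ℂ) * (b : ℂ) ^ (-(s + k)) ≠ 0) :
    AnalyticAt ℂ (continuation b A) s := by
  obtain ⟨n, hn⟩ := exists_nat_gt (Real.logb b A.card - s.re)
  induction n generalizing s with
  | zero => exact analyticAt_continuation_of_lt hA hN hb (by simpa using hn)
  | succ n ih =>
    obtain ⟨J, T, hT, heq⟩ := exists_continuation_eq hA hN hb s
    rw [heq]
    have hd := (differentiable_one_sub_card_mul_cpow (A := A) hb).analyticAt s
    refine (hd.inv (by simpa using hs 0)).mul (((differentiable_digitSum (A := A)).analyticAt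
      s).add ((Finset.analyticAt_fun_sum _ fun j _ => ?_).add hT))
    refine ((differentiable_shiftCoeff hb _).analyticAt s).mul
      (AnalyticAt.fun_comp (f := fun s : ℂ => s + (j + 1 : ℕ)) (ih _ ?_ ?_) (by fun_prop))
    · intro k
      have := hs (j + 1 + k)
      rwa [Nat.cast_add, ← add_assoc] at this
    simp only [Complex.add_re, Complex.natCast_re]
    push_cast at hn ⊢
    linarith [(Nat.cast_nonneg j : (0 : ℝ) ≤ j)]

theorem analyticAt_continuation_neg_nat (hA : ∀ a ∈ A, a < b) (hN : 1 < A.card)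
    (hNb : A.card < b) (m : ℕ) : AnalyticAt ℂ (continuation b A) (-(m : ℂ)) := by
  refine analyticAt_continuation hA hN (hN.trans hNb) _ fun k => ?_
  have := one_sub_card_mul_cpow_int_ne_zero hN hNb (-(m : ℤ) + k)
  push_cast at this
  exact this

theorem exists_isContinuation (hA : ∀ a ∈ A, a < b) (hN : 1 < A.card) (hNb : A.card < b) :
    ∃ K : ℂ → ℂ, IsContinuation b A K := by
  have hb := hN.trans hNb
  have hm : MeromorphicOn (continuation b A) Set.univ := fun s _ =>
    meromorphicAt_continuation hA hN hb s
  refine ⟨toMeromorphicNFOn (continuation b A) Set.univ,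
    meromorphicNFOn_toMeromorphicNFOn _ _, fun s hs => ?_⟩
  rw [toMeromorphicNFOn_eq_toMeromorphicNFAt hm trivial,
    toMeromorphicNFAt_eq_self.2 (analyticAt_continuation_of_lt hA hN hb hs).meromorphicNFAt,
    continuation_of_lt hs]
  exact (lseriesSummable_coeff hA hN hb hs).LSeriesHasSum

/-- The identity theorem gives agreement on a punctured neighbourhood; normal form of `K` and
analyticity of the other function extend it to the centre. -/
theorem IsContinuation.eventuallyEq {K : ℂ → ℂ} (hK : IsContinuation b A K)
    (hA : ∀ a ∈ A, a < b) (hN : 1 < A.card) (hb : 1 < b) {s : ℂ}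
    (hs : AnalyticAt ℂ (continuation b A) s) : K =ᶠ[𝓝 s] continuation b A := by
  rw [← (hK.meromorphic trivial).eventuallyEq_nhdsNE_iff_eventuallyEq_nhds hs.meromorphicNFAt]
  refine eventuallyEq_nhdsNE_of_eventuallyEq_nhds
    (fun z => (hK.meromorphic trivial).meromorphicAt) (meromorphicAt_continuation hA hN hb)
    (z₀ := ((Real.logb b A.card + 1 : ℝ) : ℂ)) ?_ s
  filter_upwards [(isOpen_lt continuous_const Complex.continuous_re).mem_nhds
    (show Real.logb b A.card < ((Real.logb b A.card + 1 : ℝ) : ℂ).re by simp)] with w hw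
  rw [continuation_of_lt hw, (hK.hasSum w hw).LSeries_eq]

/-! ### The functional equation at nonpositive integers. -/

/-- At `m = 0` the two sides differ when `0 ∈ A`, because `0 ^ 0 = 1`; this is why `K(0)` involves
`N_1`. -/
theorem digitSum_neg_nat_of_pos {m : ℕ} (hm : m ≠ 0) : digitSum A (-(m : ℂ)) = powerSum A m := by
  simp only [digitSum, neg_neg, Complex.cpow_natCast]
  exact Finset.sum_erase A (by simp [hm])

theorem continuation_neg_nat (hA : ∀ a ∈ A, a < b) (hN : 1 < A.card) (hNb : A.card < b) (m : ℕ) :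
    (1 / (b : ℂ) ^ m - A.card) * continuation b A (-(m : ℂ)) =
      digitSum A (-(m : ℂ)) / (b : ℂ) ^ m + ∑ j ∈ Finset.Icc 1 m, (m.choose j : ℂ) *
        (powerSum A j / (b : ℂ) ^ j) * continuation b A (-(m : ℂ) + (j : ℂ)) := by
  have hb0 : (b : ℂ) ≠ 0 := by exact_mod_cast (by omega : b ≠ 0)
  have h0 := one_sub_card_mul_cpow_int_ne_zero hN hNb (-(m : ℤ))
  have h := continuation_eq hA hN (hN.trans hNb) (-(m : ℂ))
  push_cast at h0
  rw [eq_inv_mul_iff_mul_eq₀ h0, neg_neg, Complex.cpow_natCast,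
    tsum_eq_sum (s := Finset.range m)] at h
  · have e : ∑ j ∈ Finset.range m, shiftCoeff b A (-(m : ℂ)) (j + 1) *
        continuation b A (-(m : ℂ) + (j + 1 : ℕ)) = (b : ℂ) ^ m * ∑ j ∈ Finset.Icc 1 m,
        (m.choose j : ℂ) * (powerSum A j / (b : ℂ) ^ j) *
          continuation b A (-(m : ℂ) + (j : ℂ)) := by
      rw [Finset.mul_sum, ← Finset.Ico_add_one_right_eq_Icc, Finset.sum_Ico_eq_sum_range,
        Nat.add_sub_cancel]
      refine Finset.sum_congr rfl fun j _ => ?_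
      rw [add_comm 1 j, shiftCoeff, neg_neg, Ring.choose_natCast, neg_add, neg_neg,
        Complex.cpow_add _ _ hb0, Complex.cpow_neg, Complex.cpow_natCast, Complex.cpow_natCast]
      ring
    rw [e] at h
    have hbm : (b : ℂ) ^ m ≠ 0 := pow_ne_zero _ hb0
    apply mul_left_cancel₀ hbm
    rw [mul_add, ← mul_assoc, mul_sub, mul_one_div_cancel hbm, mul_div_cancel₀ _ hbm, ← h]
    ring
  · intro j hj
    rw [Finset.mem_range, not_lt] at hj
    rw [shiftCoeff, neg_neg, Ring.choose_natCast, Nat.choose_eq_zero_of_lt (by omega)]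
    simp

/-! ### The explicit series: convergence, functional equation, analyticity. -/

theorem term_zero (t : ℂ) : term b A 0 t = 1 := by simp [term]

theorem term_succ (k : ℕ) (t : ℂ) :
    term b A (k + 1) t = (alpha A (t / b))⁻¹ * term b A k (t / b) := by
  have h (k : ℕ) (t : ℂ) : ∏ j ∈ Finset.Icc 1 k, alpha A (t / (b : ℂ) ^ j) =
      ∏ j ∈ Finset.range k, alpha A (t / (b : ℂ) ^ (j + 1)) := by
    rw [← Finset.Ico_add_one_right_eq_Icc, Finset.prod_Ico_eq_prod_range, Nat.add_sub_cancel]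
    simp only [add_comm 1]
  rw [term, term, h, h, Finset.prod_range_succ', one_div, one_div, mul_inv, mul_comm]
  simp only [zero_add, pow_one, div_div, ← pow_succ']

theorem differentiable_alpha : Differentiable ℂ (alpha A) := by
  unfold alpha
  fun_prop

theorem alpha_zero : alpha A 0 = A.card := by simp [alpha]

theorem exists_le_norm_alpha (hN : 1 < A.card) :
    ∃ δ : ℝ, 0 < δ ∧ ∀ z : ℂ, ‖z‖ < δ → 3 / 2 ≤ ‖alpha A z‖ := by
  have hc : ContinuousAt (fun z => ‖alpha A z‖) 0 :=
    (differentiable_alpha.continuous.norm).continuousAt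
  have h2 : (2 : ℝ) ≤ A.card := by exact_mod_cast hN
  -- Any constant strictly between 1 and 2 would do, as `α_A(0) = N ≥ 2`; its inverse is the ratio
  -- `2 / 3` below.
  have h0 : (3 / 2 : ℝ) < ‖alpha A 0‖ := by
    rw [alpha_zero, Complex.norm_natCast]
    linarith
  obtain ⟨δ, hδ, h⟩ := Metric.eventually_nhds_iff.1 (hc.eventually_const_lt h0)
  exact ⟨δ, hδ, fun z hz => (h (by simpa using hz)).le⟩

theorem norm_div_lt (hb : 1 < b) {t : ℂ} {δ : ℝ} (h : ‖t‖ < δ) : ‖t / b‖ < δ := by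
  rw [norm_div, Complex.norm_natCast]
  exact (div_le_self (norm_nonneg t) (by exact_mod_cast hb.le)).trans_lt h

/-- Repeated division by `b` brings any `t` into the disc. This carries local facts about the series
to the whole plane. -/
theorem forall_of_forall_div (hb : 1 < b) {P : ℂ → Prop} {δ : ℝ} (hδ : 0 < δ)
    (h0 : ∀ t, ‖t‖ < δ → P t) (hs : ∀ t, P (t / b) → P t) (t : ℂ) : P t := by
  have key (n : ℕ) : ∀ t, P (t / (b : ℂ) ^ n) → P t := by
    induction n with
    | zero => simp
    | succ n ih =>
      intro t h
      refine hs t (ih _ ?_)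
      rwa [div_div, ← pow_succ']
  obtain ⟨n, hn⟩ := pow_unbounded_of_one_lt (‖t‖ / δ)
    (show (1 : ℝ) < b by exact_mod_cast hb)
  refine key n t (h0 _ ?_)
  rw [norm_div, norm_pow, Complex.norm_natCast, div_lt_iff₀ (by positivity)]
  rwa [div_lt_iff₀ hδ, mul_comm] at hn

theorem norm_term_le_pow (hb : 1 < b) {δ : ℝ} (hδ : ∀ z : ℂ, ‖z‖ < δ → 3 / 2 ≤ ‖alpha A z‖)
    (k : ℕ) {t : ℂ} (ht : ‖t‖ < δ) : ‖term b A k t‖ ≤ (2 / 3) ^ k := by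
  induction k generalizing t with
  | zero => simp [term_zero]
  | succ k ih =>
    have h1 := norm_div_lt hb ht
    rw [term_succ, norm_mul, norm_inv, pow_succ']
    refine mul_le_mul ?_ (ih h1) (norm_nonneg _) (by norm_num)
    rw [show (2 / 3 : ℝ) = (3 / 2)⁻¹ by norm_num]
    exact inv_anti₀ (by norm_num) (hδ _ h1)

theorem differentiableAt_term (hb : 1 < b) {δ : ℝ}
    (hδ : ∀ z : ℂ, ‖z‖ < δ → 3 / 2 ≤ ‖alpha A z‖) (k : ℕ) {t : ℂ} (ht : ‖t‖ < δ) :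
    DifferentiableAt ℂ (term b A k) t := by
  induction k generalizing t with
  | zero => simp [funext (term_zero (b := b) (A := A))]
  | succ k ih =>
    have h1 := norm_div_lt hb ht
    rw [funext (term_succ (b := b) (A := A) k)]
    have hd : DifferentiableAt ℂ (fun t : ℂ => t / b) t := by fun_prop
    refine ((differentiable_alpha (t / b)).fun_comp' t hd |>.fun_inv ?_).fun_mul
      ((ih h1).fun_comp' t hd)
    exact norm_pos_iff.1 (lt_of_lt_of_le (by norm_num) (hδ _ h1))

/-- No point has to be excluded: if some `α_A(b^(-j) t)` vanishes, then division by zero makes the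
terms from index `j` on equal to 0. -/
theorem exists_norm_term_le (hb : 1 < b) (hN : 1 < A.card) (t : ℂ) :
    ∃ c : ℝ, ∀ k : ℕ, ‖term b A k t‖ ≤ c * (2 / 3) ^ k := by
  obtain ⟨δ, hδ, h⟩ := exists_le_norm_alpha hN
  refine forall_of_forall_div (P := fun t => ∃ c : ℝ, ∀ k : ℕ, ‖term b A k t‖ ≤ c * (2 / 3) ^ k)
    hb hδ (fun t ht => ⟨1, fun k => ?_⟩) (fun t ⟨c, hc⟩ => ?_) t
  · rw [one_mul]
    exact norm_term_le_pow hb h k ht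
  · have hc0 : 0 ≤ c := by simpa using (norm_nonneg _).trans (hc 0)
    refine ⟨1 + ‖(alpha A (t / b))⁻¹‖ * c * (3 / 2), fun k => ?_⟩
    cases k with
    | zero =>
      rw [term_zero, norm_one, pow_zero, mul_one]
      have : 0 ≤ ‖(alpha A (t / b))⁻¹‖ * c * (3 / 2) := by positivity
      linarith
    | succ k =>
      rw [term_succ, norm_mul]
      calc _ ≤ ‖(alpha A (t / b))⁻¹‖ * (c * (2 / 3) ^ k) := by gcongr; exact hc k
        _ = ‖(alpha A (t / b))⁻¹‖ * c * (3 / 2) * (2 / 3) ^ (k + 1) := by ring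
        _ ≤ _ := by gcongr; linarith

theorem summable_term (hb : 1 < b) (hN : 1 < A.card) (t : ℂ) :
    Summable fun k => term b A k t := by
  obtain ⟨c, hc⟩ := exists_norm_term_le hb hN t
  exact Summable.of_norm_bounded
    ((summable_geometric_of_lt_one (by norm_num) (by norm_num)).mul_left c) hc

/-- The sum of the explicit series for the exponential generating function. -/
noncomputable def egfSum (b : ℕ) (A : Finset ℕ) (t : ℂ) : ℂ := -1 - ∑' k, term b A (k + 1) t

/-- Factor `1 / α_A(t / b)` out of the series. Written with an inverse, the identity also holds at
zeros of `α_A(t / b)`, where both sides are `-1`. -/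
theorem egfSum_eq (hb : 1 < b) (hN : 1 < A.card) (t : ℂ) :
    egfSum b A t = (alpha A (t / b))⁻¹ * egfSum b A (t / b) - 1 := by
  have h := (summable_term hb hN (t / b)).tsum_eq_zero_add
  rw [term_zero] at h
  rw [egfSum, egfSum]
  simp only [term_succ _ t, tsum_mul_left, h]
  ring

theorem differentiableOn_egfSum (hb : 1 < b) {δ : ℝ}
    (hδ : ∀ z : ℂ, ‖z‖ < δ → 3 / 2 ≤ ‖alpha A z‖) :
    DifferentiableOn ℂ (egfSum b A) (Metric.ball 0 δ) := by
  refine (Complex.differentiableOn_tsum_of_summable_norm (u := fun k => (2 / 3 : ℝ) ^ (k + 1))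
    ((summable_nat_add_iff 1).2 (summable_geometric_of_lt_one (by norm_num) (by norm_num)))
    (fun k t ht => ?_) Metric.isOpen_ball fun k t ht => ?_).const_sub (-1)
  · exact (differentiableAt_term hb hδ _ (mem_ball_zero_iff.1 ht)).differentiableWithinAt
  · exact norm_term_le_pow hb hδ _ (mem_ball_zero_iff.1 ht)

theorem analyticAt_egfSum_of_norm_lt (hb : 1 < b) {δ : ℝ}
    (hδ : ∀ z : ℂ, ‖z‖ < δ → 3 / 2 ≤ ‖alpha A z‖) {t : ℂ} (ht : ‖t‖ < δ) :
    AnalyticAt ℂ (egfSum b A) t :=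
  (differentiableOn_egfSum hb hδ).analyticAt
    (Metric.isOpen_ball.mem_nhds (mem_ball_zero_iff.2 ht))

theorem meromorphicAt_egfSum (hb : 1 < b) (hN : 1 < A.card) (t : ℂ) :
    MeromorphicAt (egfSum b A) t := by
  obtain ⟨δ, hδ, h⟩ := exists_le_norm_alpha hN
  refine forall_of_forall_div hb hδ
    (fun t ht => (analyticAt_egfSum_of_norm_lt hb h ht).meromorphicAt) (fun t ht => ?_) t
  rw [funext (egfSum_eq (A := A) hb hN)]
  have hd : AnalyticAt ℂ (fun t : ℂ => t / b) t := by fun_prop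
  exact ((((differentiable_alpha (A := A)).analyticAt (t / b)).fun_comp
    (f := fun t : ℂ => t / b) hd).meromorphicAt.inv.mul
    (ht.comp_analyticAt (g := fun t : ℂ => t / b) hd)).sub (MeromorphicAt.const 1 t)

theorem div_notMem_exceptionalSet {t : ℂ} (hb : 1 < b) (ht : t ∉ exceptionalSet b A) :
    t / b ∉ exceptionalSet b A := by
  rintro ⟨j, hj, z, hz, h⟩
  refine ht ⟨j + 1, by omega, z, hz, ?_⟩
  have hb0 : (b : ℂ) ≠ 0 := by exact_mod_cast (by omega : b ≠ 0)
  rw [div_eq_iff hb0] at h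
  rw [h]
  ring

theorem alpha_div_ne_zero {t : ℂ} (hb : 1 < b) (ht : t ∉ exceptionalSet b A) :
    alpha A (t / b) ≠ 0 := by
  intro h
  have hb0 : (b : ℂ) ≠ 0 := by exact_mod_cast (by omega : b ≠ 0)
  exact ht ⟨1, le_rfl, t / b, h, by field_simp⟩

theorem analyticAt_egfSum (hb : 1 < b) (hN : 1 < A.card) (t : ℂ) :
    t ∉ exceptionalSet b A → AnalyticAt ℂ (egfSum b A) t := by
  obtain ⟨δ, hδ, h⟩ := exists_le_norm_alpha hN
  refine forall_of_forall_div
    (P := fun t => t ∉ exceptionalSet b A → AnalyticAt ℂ (egfSum b A) t) hb hδ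
    (fun t ht _ => analyticAt_egfSum_of_norm_lt hb h ht) (fun t ih ht => ?_) t
  have hd : AnalyticAt ℂ (fun t : ℂ => t / b) t := by fun_prop
  rw [funext (egfSum_eq (A := A) hb hN)]
  exact ((((differentiable_alpha (A := A)).analyticAt (t / b)).fun_comp
    (f := fun t : ℂ => t / b) hd).inv (alpha_div_ne_zero hb ht)).mul
    ((ih (div_notMem_exceptionalSet hb ht)).fun_comp (f := fun t : ℂ => t / b) hd)
    |>.sub analyticAt_const

/-! ### Taylor coefficients and the recurrence determining them. -/

theorem iteratedDeriv_comp_mul_left (f : ℂ → ℂ) (c : ℂ) (n : ℕ) (x : ℂ) :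
    iteratedDeriv n (fun t => f (c * t)) x = c ^ n * iteratedDeriv n f (c * x) := by
  induction n generalizing x with
  | zero => simp
  | succ n ih =>
    rw [iteratedDeriv_succ, funext ih, deriv_const_mul_field, deriv_comp_mul_left,
      ← iteratedDeriv_succ, smul_eq_mul]
    ring

theorem iteratedDeriv_alpha_zero (n : ℕ) : iteratedDeriv n (alpha A) 0 = powerSum A n := by
  unfold alpha powerSum
  rw [iteratedDeriv_fun_sum fun a _ => by fun_prop]
  simp [iteratedDeriv_cexp_const_mul]

/-- The recurrence that the functional equation imposes on Taylor coefficients at `0`. -/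
def SatisfiesRecurrence (b : ℕ) (A : Finset ℕ) (x : ℕ → ℂ) : Prop :=
  ∀ m : ℕ, (b : ℂ)⁻¹ ^ m * x m = (b : ℂ)⁻¹ ^ m * powerSum A m +
    ∑ i ∈ Finset.range (m + 1), (m.choose i : ℂ) * ((b : ℂ)⁻¹ ^ i * powerSum A i) * x (m - i)

theorem powerSum_zero : powerSum A 0 = A.card := by simp [powerSum]

/-- Isolating `i = 0` leaves `(b^(-m) - N) x_m` in terms of earlier values, and `b^(-m) ≤ 1 < N`. -/
theorem SatisfiesRecurrence.unique (hN : 1 < A.card) (hb : 1 < b) {x y : ℕ → ℂ}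
    (hx : SatisfiesRecurrence b A x) (hy : SatisfiesRecurrence b A y) (m : ℕ) : x m = y m := by
  induction m using Nat.strong_induction_on with
  | _ m ih =>
    have h1 := hx m
    have h2 := hy m
    rw [Finset.sum_range_succ'] at h1 h2
    rw [Finset.sum_congr rfl (fun i hi => by
      rw [ih (m - (i + 1)) (by have := Finset.mem_range.1 hi; omega)])] at h1
    simp only [Nat.choose_zero_right, Nat.cast_one, pow_zero, one_mul, powerSum_zero,
      Nat.sub_zero] at h1 h2
    have hne : (b : ℂ)⁻¹ ^ m - A.card ≠ 0 := by
      intro h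
      rw [sub_eq_zero] at h
      have h3 := congrArg (‖·‖) h
      simp only [norm_pow, norm_inv, Complex.norm_natCast] at h3
      have h4 : (b : ℝ)⁻¹ ^ m ≤ 1 :=
        pow_le_one₀ (by positivity) (inv_le_one_of_one_le₀ (by exact_mod_cast hb.le))
      have h5 : (1 : ℝ) < A.card := by exact_mod_cast hN
      linarith
    apply mul_left_cancel₀ hne
    linear_combination h1 - h2

/-- Differentiate the functional equation `m` times at 0, with the Leibniz rule for the product. -/
theorem satisfiesRecurrence_iteratedDeriv (hb : 1 < b) (hN : 1 < A.card) :
    SatisfiesRecurrence b A fun m => iteratedDeriv m (egfSum b A) 0 := by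
  intro m
  obtain ⟨δ, hδ, h⟩ := exists_le_norm_alpha hN
  have heq : (fun t => egfSum b A ((b : ℂ)⁻¹ * t)) =ᶠ[𝓝 0] fun t =>
      alpha A ((b : ℂ)⁻¹ * t) + alpha A ((b : ℂ)⁻¹ * t) * egfSum b A t := by
    filter_upwards [Metric.ball_mem_nhds (0 : ℂ) hδ] with t ht
    have h1 := h _ (norm_div_lt hb (mem_ball_zero_iff.1 ht))
    have h2 : alpha A (t / b) ≠ 0 := norm_pos_iff.1 (lt_of_lt_of_le (by norm_num) h1)
    rw [egfSum_eq hb hN t, inv_mul_eq_div]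
    field_simp
    ring
  have hα : ContDiffAt ℂ m (fun t => alpha A ((b : ℂ)⁻¹ * t)) 0 := by
    unfold alpha
    fun_prop
  have hC : ContDiffAt ℂ m (egfSum b A) 0 :=
    (analyticAt_egfSum_of_norm_lt hb h (by simpa)).contDiffAt
  have e := heq.iteratedDeriv_eq m
  rw [iteratedDeriv_comp_mul_left, iteratedDeriv_fun_add hα (hα.mul hC),
    iteratedDeriv_fun_mul hα hC] at e
  simpa only [iteratedDeriv_comp_mul_left, mul_zero, iteratedDeriv_alpha_zero] using e

theorem coeff_alphaSeries (m : ℕ) :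
    PowerSeries.coeff m (alphaSeries A) = powerSum A m / m.factorial := by
  simp [alphaSeries, powerSum, PowerSeries.coeff_rescale, PowerSeries.coeff_exp, Finset.sum_mul,
    div_eq_mul_inv]

/-- Division by `m!` turns the binomial convolution into a Cauchy product. -/
theorem rescale_egf_eq {K : ℂ → ℂ} (h : SatisfiesRecurrence b A fun m => K (-(m : ℂ))) :
    PowerSeries.rescale ((b : ℂ)⁻¹) (egf K) = PowerSeries.rescale ((b : ℂ)⁻¹) (alphaSeries A) +
      PowerSeries.rescale ((b : ℂ)⁻¹) (alphaSeries A) * egf K := by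
  ext m
  have hm : (m.factorial : ℂ) ≠ 0 := by exact_mod_cast m.factorial_ne_zero
  rw [map_add, PowerSeries.coeff_mul, Finset.Nat.sum_antidiagonal_eq_sum_range_succ_mk]
  simp only [PowerSeries.coeff_rescale, coeff_alphaSeries, egf, PowerSeries.coeff_mk]
  rw [← mul_div_assoc, h m, add_div, Finset.sum_div, mul_div_assoc]
  congr 1
  refine Finset.sum_congr rfl fun i hi => ?_
  have hi' : i ≤ m := by have := Finset.mem_range.1 hi; omega
  rw [Nat.cast_choose ℂ hi']
  have h1 : (i.factorial : ℂ) ≠ 0 := by exact_mod_cast i.factorial_ne_zero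
  have h2 : ((m - i).factorial : ℂ) ≠ 0 := by exact_mod_cast (m - i).factorial_ne_zero
  field_simp

/-! ### The values of K at nonpositive integers. -/

variable {K : ℂ → ℂ}

theorem IsContinuation.analyticAt_neg_nat (hK : IsContinuation b A K) (hA : ∀ a ∈ A, a < b)
    (hN : 1 < A.card) (hNb : A.card < b) (m : ℕ) : AnalyticAt ℂ K (-(m : ℂ)) :=
  have h := analyticAt_continuation_neg_nat hA hN hNb m
  h.congr (hK.eventuallyEq hA hN (hN.trans hNb) h).symm

theorem IsContinuation.recurrence (hK : IsContinuation b A K) (hA : ∀ a ∈ A, a < b)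
    (hN : 1 < A.card) (hNb : A.card < b) (m : ℕ) :
    (1 / (b : ℂ) ^ m - A.card) * K (-(m : ℂ)) =
      digitSum A (-(m : ℂ)) / (b : ℂ) ^ m + ∑ j ∈ Finset.Icc 1 m, (m.choose j : ℂ) *
        (powerSum A j / (b : ℂ) ^ j) * K (-(m : ℂ) + (j : ℂ)) := by
  have e (m : ℕ) : K (-(m : ℂ)) = continuation b A (-(m : ℂ)) :=
    (hK.eventuallyEq hA hN (hN.trans hNb)
      (analyticAt_continuation_neg_nat hA hN hNb m)).eq_of_nhds
  rw [e, continuation_neg_nat hA hN hNb]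
  congr 1
  refine Finset.sum_congr rfl fun j hj => ?_
  have hj' := (Finset.mem_Icc.1 hj).2
  rw [show -(m : ℂ) + j = -((m - j : ℕ) : ℂ) by push_cast [hj']; ring, e]

theorem IsContinuation.apply_zero (hK : IsContinuation b A K) (hA : ∀ a ∈ A, a < b)
    (hN : 1 < A.card) (hNb : A.card < b) :
    K 0 = -((A.erase 0).card : ℂ) / ((A.card : ℂ) - 1) := by
  have h := hK.recurrence hA hN hNb 0
  simp only [digitSum, Nat.cast_zero, neg_zero, Complex.cpow_zero, Finset.sum_const,
    nsmul_eq_mul, mul_one, pow_zero, div_one, Finset.Icc_eq_empty_of_lt one_pos,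
    Finset.sum_empty, add_zero] at h
  have hne : (A.card : ℂ) - 1 ≠ 0 := by
    rw [sub_ne_zero]
    exact_mod_cast hN.ne'
  rw [eq_div_iff hne]
  linear_combination -h

theorem one_div_pow_sub_card_ne_zero (hN : 1 < A.card) (hb : 1 < b) (m : ℕ) :
    1 / (b : ℂ) ^ m - A.card ≠ 0 := by
  intro h
  have h3 := congrArg (‖·‖) (sub_eq_zero.1 h)
  simp only [norm_div, norm_one, norm_pow, Complex.norm_natCast] at h3
  have h4 : 1 / (b : ℝ) ^ m ≤ 1 := by
    rw [div_le_one (by positivity)]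
    exact one_le_pow₀ (by exact_mod_cast hb.le)
  have h5 : (1 : ℝ) < A.card := by exact_mod_cast hN
  linarith

theorem IsContinuation.exists_rat (hK : IsContinuation b A K) (hA : ∀ a ∈ A, a < b)
    (hN : 1 < A.card) (hNb : A.card < b) (m : ℕ) : ∃ q : ℚ, K (-(m : ℂ)) = q := by
  suffices h : ∀ m : ℕ, K (-(m : ℂ)) ∈ (algebraMap ℚ ℂ).fieldRange by
    obtain ⟨q, hq⟩ := h m
    exact ⟨q, by rw [← hq]; simp⟩
  intro m
  induction m using Nat.strong_induction_on with
  | _ m ih =>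
    have hp (j : ℕ) : powerSum A j ∈ (algebraMap ℚ ℂ).fieldRange :=
      sum_mem fun a _ => pow_mem (natCast_mem _ _) _
    have hd : digitSum A (-(m : ℂ)) ∈ (algebraMap ℚ ℂ).fieldRange := by
      refine sum_mem fun a _ => ?_
      rw [neg_neg, Complex.cpow_natCast]
      exact pow_mem (natCast_mem _ _) _
    have hbp (j : ℕ) : (b : ℂ) ^ j ∈ (algebraMap ℚ ℂ).fieldRange :=
      pow_mem (natCast_mem _ _) _
    have hr := hK.recurrence hA hN hNb m
    rw [mul_comm, ← eq_div_iff (one_div_pow_sub_card_ne_zero hN (hN.trans hNb) m)] at hr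
    rw [hr]
    refine div_mem (add_mem (div_mem hd (hbp m)) (sum_mem fun j hj => ?_))
      (sub_mem (div_mem (one_mem _) (hbp m)) (natCast_mem _ _))
    obtain ⟨hj1, hj2⟩ := Finset.mem_Icc.1 hj
    refine mul_mem (mul_mem (natCast_mem _ _) (div_mem (hp j) (hbp j))) ?_
    rw [show -(m : ℂ) + j = -((m - j : ℕ) : ℂ) by push_cast [hj2]; ring]
    exact ih _ (by omega)

theorem IsContinuation.apply_zero_of_zero_mem (hK : IsContinuation b A K)
    (hA : ∀ a ∈ A, a < b) (hN : 1 < A.card) (hNb : A.card < b) (h0 : 0 ∈ A) : K 0 = -1 := by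
  rw [hK.apply_zero hA hN hNb, Finset.card_erase_of_mem h0, Nat.cast_sub hN.le, Nat.cast_one]
  rw [neg_div, div_self]
  rw [sub_ne_zero]
  exact_mod_cast hN.ne'

theorem IsContinuation.re_apply_zero_lt (hK : IsContinuation b A K) (hA : ∀ a ∈ A, a < b)
    (hN : 1 < A.card) (hNb : A.card < b) (h0 : 0 ∉ A) : (K 0).re < -1 := by
  have h1 : (1 : ℝ) < A.card := by exact_mod_cast hN
  have e : K 0 = ((-(A.card : ℝ) / (A.card - 1) : ℝ) : ℂ) := by
    rw [hK.apply_zero hA hN hNb, Finset.erase_eq_of_notMem h0]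
    push_cast
    rfl
  rw [e, Complex.ofReal_re, div_lt_iff₀ (by linarith)]
  linarith

/-- By induction only `j = m` survives in the sum; it equals `γ_m b^(-m) K(0) = -γ_m b^(-m)` and
cancels the leading term. -/
theorem IsContinuation.apply_neg_nat_of_zero_mem (hK : IsContinuation b A K)
    (hA : ∀ a ∈ A, a < b) (hN : 1 < A.card) (hNb : A.card < b) (h0 : 0 ∈ A) (m : ℕ)
    (hm : 1 ≤ m) : K (-(m : ℂ)) = 0 := by
  induction m using Nat.strong_induction_on with
  | _ m ih =>
    have h := hK.recurrence hA hN hNb m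
    rw [digitSum_neg_nat_of_pos (by omega), Finset.sum_eq_single_of_mem m
      (Finset.mem_Icc.2 ⟨hm, le_rfl⟩)] at h
    · rw [neg_add_cancel, hK.apply_zero_of_zero_mem hA hN hNb h0, Nat.choose_self, Nat.cast_one,
        one_mul, mul_neg_one, add_neg_cancel] at h
      exact (mul_eq_zero.1 h).resolve_left
        (one_div_pow_sub_card_ne_zero hN (hN.trans hNb) m)
    · intro j hj hne
      obtain ⟨hj1, hj2⟩ := Finset.mem_Icc.1 hj
      rw [show -(m : ℂ) + j = -((m - j : ℕ) : ℂ) by push_cast [hj2]; ring,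
        ih _ (by omega) (by omega), mul_zero]

/-- Without the digit 0, `digitSum` at `-m` is `γ_m` for `m = 0` too, so the recurrence holds from
the start; `N K(-m)` returns to the sum as `i = 0`. -/
theorem IsContinuation.satisfiesRecurrence (hK : IsContinuation b A K) (hA : ∀ a ∈ A, a < b)
    (hN : 1 < A.card) (hNb : A.card < b) (h0 : 0 ∉ A) :
    SatisfiesRecurrence b A fun m => K (-(m : ℂ)) := by
  intro m
  have h := hK.recurrence hA hN hNb m
  have hd : digitSum A (-(m : ℂ)) = powerSum A m := by
    simp [digitSum, powerSum, Finset.erase_eq_of_notMem h0]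
  rw [hd, ← Finset.Ico_add_one_right_eq_Icc, Finset.sum_Ico_eq_sum_range,
    Nat.add_sub_cancel] at h
  rw [Finset.sum_range_succ', Finset.sum_congr rfl (g := fun i => (m.choose (1 + i) : ℂ) *
    (powerSum A (1 + i) / (b : ℂ) ^ (1 + i)) * K (-(m : ℂ) + ((1 + i : ℕ) : ℂ)))]
  · simp only [Nat.choose_zero_right, Nat.cast_one, pow_zero, one_mul, powerSum_zero,
      Nat.sub_zero, inv_pow]
    rw [one_div, div_eq_inv_mul] at h
    linear_combination h
  · intro i hi
    have hi' : i + 1 ≤ m := Finset.mem_range.1 hi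
    rw [add_comm 1 i, show -(m : ℂ) + (i + 1 : ℕ) = -((m - (i + 1) : ℕ) : ℂ) by
      push_cast [hi']; ring, inv_pow, inv_mul_eq_div]

theorem IsContinuation.hasSum_egfSum (hK : IsContinuation b A K) (hA : ∀ a ∈ A, a < b)
    (hN : 1 < A.card) (hNb : A.card < b) (h0 : 0 ∉ A) {δ : ℝ}
    (hδ : ∀ z : ℂ, ‖z‖ < δ → 3 / 2 ≤ ‖alpha A z‖) {t : ℂ} (ht : ‖t‖ < δ) :
    HasSum (fun m : ℕ => K (-(m : ℂ)) * (t ^ m / (m.factorial : ℂ))) (egfSum b A t) := by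
  have hb := hN.trans hNb
  have h := Complex.hasSum_taylorSeries_on_ball (differentiableOn_egfSum hb hδ)
    (mem_ball_zero_iff.2 ht)
  refine h.congr_fun fun m => ?_
  have e := (hK.satisfiesRecurrence hA hN hNb h0).unique hN hb
    (satisfiesRecurrence_iteratedDeriv hb hN) m
  rw [e, sub_zero, smul_eq_mul, smul_eq_mul]
  ring

end RestrictedDirichlet

/-! ### Assembly of the main theorem. -/

theorem mainTheorem5 (b : ℕ) (A : Finset ℕ) (hA : ∀ a ∈ A, a < b)
    (hN : 1 < A.card) (hNb : A.card < b) :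
    (∃ K : ℂ → ℂ, RestrictedDirichlet.IsContinuation b A K) ∧
    ∀ K : ℂ → ℂ, RestrictedDirichlet.IsContinuation b A K →
      -- the values are genuine (no poles) and rational
      (∀ m : ℕ, AnalyticAt ℂ K (-(m : ℂ))) ∧
      (∀ m : ℕ, ∃ q : ℚ, K (-(m : ℂ)) = (q : ℂ)) ∧
      K 0 = -((A.erase 0).card : ℂ) / ((A.card : ℂ) - 1) ∧
      -- the recurrence
      (∀ m : ℕ, 1 ≤ m →
        (1 / (b : ℂ) ^ m - (A.card : ℂ)) * K (-(m : ℂ)) =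
          RestrictedDirichlet.powerSum A m / (b : ℂ) ^ m +
            ∑ j ∈ Finset.Icc 1 m, (m.choose j : ℂ) *
              (RestrictedDirichlet.powerSum A j / (b : ℂ) ^ j) * K (-(m : ℂ) + (j : ℂ))) ∧
      -- the two cases and their equivalent descriptions
      (0 ∈ A ↔ K 0 = -1) ∧
      (0 ∉ A ↔ (A.erase 0).card = A.card) ∧
      (0 ∉ A ↔ (K 0).re < -1) ∧
      (0 ∈ A → ∀ m : ℕ, 1 ≤ m → K (-(m : ℂ)) = 0) ∧
      (0 ∉ A →
        -- the functional equation for formal power series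
        PowerSeries.rescale ((b : ℂ)⁻¹) (RestrictedDirichlet.egf K) =
          PowerSeries.rescale ((b : ℂ)⁻¹) (RestrictedDirichlet.alphaSeries A) +
            PowerSeries.rescale ((b : ℂ)⁻¹) (RestrictedDirichlet.alphaSeries A) *
              RestrictedDirichlet.egf K ∧
        ∃ C : ℂ → ℂ, MeromorphicNFOn C Set.univ ∧
          -- positive radius of convergence, with sum `C` near `0`
          (∃ r : ℝ, 0 < r ∧ ∀ t : ℂ, ‖t‖ < r →
            HasSum (fun m : ℕ => K (-(m : ℂ)) * (t ^ m / (m.factorial : ℂ))) (C t)) ∧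
          ∀ t : ℂ, t ∉ RestrictedDirichlet.exceptionalSet b A →
            AnalyticAt ℂ C t ∧
            -- the functional equation for the meromorphic function
            C (t / (b : ℂ)) = RestrictedDirichlet.alpha A (t / (b : ℂ)) +
              RestrictedDirichlet.alpha A (t / (b : ℂ)) * C t ∧
            -- the explicit series, which converges geometrically
            (∃ S : ℂ, HasSum (fun k : ℕ => RestrictedDirichlet.term b A (k + 1) t) S ∧
              C t = -1 - S) ∧
            ∃ c q : ℝ, 0 < q ∧ q < 1 ∧
              ∀ k : ℕ, 1 ≤ k → ‖RestrictedDirichlet.term b A k t‖ ≤ c * q ^ k) := by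
  have hb := hN.trans hNb
  refine ⟨RestrictedDirichlet.exists_isContinuation hA hN hNb, fun K hK => ?_⟩
  have hK1 := hK.apply_zero_of_zero_mem hA hN hNb
  have hK2 := hK.re_apply_zero_lt hA hN hNb
  refine ⟨hK.analyticAt_neg_nat hA hN hNb, hK.exists_rat hA hN hNb, hK.apply_zero hA hN hNb,
    fun m hm => ?_, ⟨hK1, fun h => ?_⟩, ⟨fun h => by rw [Finset.erase_eq_of_notMem h],
      fun h h0 => ?_⟩, ⟨hK2, fun h h0 => ?_⟩, hK.apply_neg_nat_of_zero_mem hA hN hNb,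
    fun h0 => ⟨RestrictedDirichlet.rescale_egf_eq (hK.satisfiesRecurrence hA hN hNb h0),
      toMeromorphicNFOn (RestrictedDirichlet.egfSum b A) Set.univ,
      meromorphicNFOn_toMeromorphicNFOn _ _, ?_, fun t ht => ?_⟩⟩
  · rw [hK.recurrence hA hN hNb m, RestrictedDirichlet.digitSum_neg_nat_of_pos (by omega)]
  · by_contra h0
    have := hK2 h0
    rw [h] at this
    norm_num at this
  · exact (Finset.card_erase_lt_of_mem h0).ne h
  · rw [hK1 h0] at h
    norm_num at h
  all_goals
    have hm : MeromorphicOn (RestrictedDirichlet.egfSum b A) Set.univ := fun t _ =>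
      RestrictedDirichlet.meromorphicAt_egfSum hb hN t
    -- Passing to normal form changes nothing near points of analyticity, so facts about `egfSum`
    -- transfer to `C` there.
    have hev (t : ℂ) (ht : AnalyticAt ℂ (RestrictedDirichlet.egfSum b A) t) :
        toMeromorphicNFOn (RestrictedDirichlet.egfSum b A) Set.univ =ᶠ[nhds t]
          RestrictedDirichlet.egfSum b A := by
      have h := toMeromorphicNFOn_eq_toMeromorphicNFAt_on_nhds hm (Set.mem_univ t)
      rwa [toMeromorphicNFAt_eq_self.2 ht.meromorphicNFAt] at h
  · obtain ⟨δ, hδ, h⟩ := RestrictedDirichlet.exists_le_norm_alpha hN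
    refine ⟨δ, hδ, fun t ht => ?_⟩
    rw [(hev t (RestrictedDirichlet.analyticAt_egfSum_of_norm_lt hb h ht)).eq_of_nhds]
    exact hK.hasSum_egfSum hA hN hNb h0 h ht
  · have hat := RestrictedDirichlet.analyticAt_egfSum hb hN t ht
    have hat' := RestrictedDirichlet.analyticAt_egfSum hb hN _
      (RestrictedDirichlet.div_notMem_exceptionalSet hb ht)
    rw [(hev _ hat).eq_of_nhds, (hev _ hat').eq_of_nhds]
    refine ⟨hat.congr (hev _ hat).symm, ?_, ⟨_, ((summable_nat_add_iff 1).2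
      (RestrictedDirichlet.summable_term hb hN t)).hasSum, rfl⟩, ?_⟩
    · have h1 := RestrictedDirichlet.alpha_div_ne_zero hb ht
      rw [RestrictedDirichlet.egfSum_eq hb hN t]
      field_simp
      ring
    · obtain ⟨c, hc⟩ := RestrictedDirichlet.exists_norm_term_le hb hN t
      exact ⟨c, 2 / 3, by norm_num, by norm_num, fun k _ => hc k⟩
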